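/- Let $(\Sigma,D)$ be a dependence alphabet ($\Sigma$ finite, $D\subseteq\Sigma\times\Sigma$ reflexive and symmetric). Two letters are independent if they are distinct and $(a,b)\notin D$. Let $\mathbb M=\Sigma^*/{\sim}$ be the trace monoid, where $\sim$ is the least congruence with $ab\sim ba$ for all independent $a,b$; let $[w]$ denote the trace of the word $w$ and $1=[\varepsilon]$. A set $\mathcal K\subseteq\mathbb M$ is recognizable if $\{w\in\Sigma^*\mid [w]\in\mathcal K\}$ is regular. Let $\mathcal F$ be the set of all sets $A\subseteq\Sigma$ of pairwise independent letters, and let $[A]\in\mathbb M$ be the product of the letters of $A$. A word $A_1\cdots A_n\in\mathcal F^*$ represents the trace $[A_1]\cdots[A_n]$; it is in extended Foata normal form if for all $1\le i<n$ every $b\in A_{i+1}$ satisfies $(a,b)\in D$ for some $a\in A_i$. For $\mathcal R\subseteq\mathbb M^2$ let $L_{\mathcal R}\subseteq(\mathcal F^2)^*$ be the set of words whose two component words are in extended Foata normal form and represent a pair of traces from $\mathcal R$. The relation $\mathcal R$ is fnf-automatic if $L_{\mathcal R}$ is regular. A trace-pushdown system (tPDS) is a tuple $\mathcal P=(Q,\Sigma,D,\Delta)$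 with $Q$ finite, $(\Sigma,D)$ a dependence alphabet and $\Delta\subseteq Q\times\Sigma\times\Sigma^*\times Q$ finite such that (P1) for every $(p,a,w,q)\in\Delta$, every letter dependent on some letter of $w$ is dependent on $a$, and (P2) if $(p,a,v,q),(q,b,w,r)\in\Delta$ with $a,b$ independent, then $(p,b,w,q'),(q',a,v,r)\in\Delta$ for some $q'\in Q$. On $Q\times\mathbb M$ let $(p,s)\vdash(q,t)$ if there are $(p,a,w,q)\in\Delta$ and $x\in\Sigma^*$ with $s=[xa]$ and $t=[xw]$. For $p,q\in Q$ let $\mathrm{reach}_{p,q}=\{(s,t)\in\mathbb M^2\mid (p,s)\vdash^*(q,t)\}$, where $\vdash^*$ is the reflexive and transitive closure of $\vdash$. **Proposition.** Let $\mathcal P=(Q,\Sigma,D,\Delta)$ be a tPDS with $\Delta\subseteq Q\times\Sigma\times\{\varepsilon\}\times Q$ and let $p,q\in Q$. Then $\mathrm{reach}_{p,q}$ is fnf-automatic, and there is a recognizable set $\mathcal K\subseteq\mathbb M$ with $$\mathrm{reach}_{p,q}=\mathrm{Id}_{\mathbb M}\cdot(\mathcal K\times\{1\})=\{(xy,x)\mid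 x\in\mathbb M,\ y\in\mathcal K\}.$$ Both statements are effective: there are algorithms that, given $\mathcal P$, $p$ and $q$, compute an NFA accepting $L_{\mathrm{reach}_{p,q}}$ and an NFA accepting $\{w\in\Sigma^*\mid[w]\in\mathcal K\}$ for such a set $\mathcal K$. -/

import Mathlib

open scoped Pointwise

/-! ## Dependence alphabets and Mazurkiewicz traces -/

/-- A dependence relation on the set of letters `Γ`: a reflexive and symmetric relation.
(Finiteness of `Γ` is a separate assumption.) -/
@[ext]
structure DependenceAlphabet (Γ : Type*) where
  Dep : Γ → Γ → Prop
  refl : ∀ a, Dep a a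
  symm : ∀ a b, Dep a b → Dep b a

namespace DependenceAlphabet

variable {Γ : Type*} (𝔻 : DependenceAlphabet Γ)

/-- The independence relation: distinct letters that are not dependent. -/
def Indep (a b : Γ) : Prop := a ≠ b ∧ ¬ 𝔻.Dep a b

/-- The generating relations `ab ∼ ba` for independent letters `a`, `b`. -/
inductive SwapRel : FreeMonoid Γ → FreeMonoid Γ → Prop
  | swap (a b : Γ) (h : 𝔻.Indep a b) :
      SwapRel (FreeMonoid.of a * FreeMonoid.of b) (FreeMonoid.of b * FreeMonoid.of a)

/-- The trace monoid: the free monoid modulo the least congruence with `ab ∼ ba` for all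
independent `a`, `b`. -/
abbrev Trace : Type _ := PresentedMonoid 𝔻.SwapRel

/-- The trace `[w]` induced by the word `w`. -/
def trace (w : List Γ) : 𝔻.Trace := PresentedMonoid.mk 𝔻.SwapRel (FreeMonoid.ofList w)

/-- A trace language is recognizable if the language of all words inducing one of its elements
is regular. -/
def Recognizable (K : Set 𝔻.Trace) : Prop :=
  Language.IsRegular ({w : List Γ | 𝔻.trace w ∈ K} : Language Γ)

/-! ### Foata normal forms -/

/-- The alphabet of all (finite) independent sets of letters. -/
abbrev IndepSet : Type _ := {A : Finset Γ // (A : Set Γ).Pairwise 𝔻.Indep}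

theorem commute_of_indep {a b : Γ} (h : 𝔻.Indep a b) :
    Commute (𝔻.trace [a]) (𝔻.trace [b]) :=
  PresentedMonoid.mk_eq_mk_of_rel (SwapRel.swap a b h)

/-- The trace `[A] = [a₁ ⋯ aₙ]` of an independent set `A = {a₁, …, aₙ}`. -/
noncomputable def IndepSet.trace {𝔻 : DependenceAlphabet Γ} (A : 𝔻.IndepSet) : 𝔻.Trace :=
  A.1.noncommProd (fun a => 𝔻.trace [a])
    (fun _ ha _ hb hab => 𝔻.commute_of_indep (A.2 ha hb hab))

/-- The trace `[A₁] ⋯ [Aₙ]` of a word `A₁ ⋯ Aₙ` of independent sets. -/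
noncomputable def foataTrace (W : List 𝔻.IndepSet) : 𝔻.Trace :=
  (W.map IndepSet.trace).prod

/-- The word `A₁ ⋯ Aₙ` is in extended Foata normal form: every letter of `Aᵢ₊₁` depends on some
letter of `Aᵢ`. -/
def IsExtendedFoata (W : List 𝔻.IndepSet) : Prop :=
  W.IsChain (fun A B => ∀ b ∈ B.1, ∃ a ∈ A.1, 𝔻.Dep a b)

/-- The language `L_R` of a binary trace relation `R`, over pairs of independent sets. -/
def foataLanguage (R : Set (𝔻.Trace × 𝔻.Trace)) : Language (𝔻.IndepSet × 𝔻.IndepSet) :=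
  {W | 𝔻.IsExtendedFoata (W.map Prod.fst) ∧ 𝔻.IsExtendedFoata (W.map Prod.snd) ∧
    (𝔻.foataTrace (W.map Prod.fst), 𝔻.foataTrace (W.map Prod.snd)) ∈ R}

/-- A binary trace relation is fnf-automatic if its language `L_R` is regular. -/
def FnfAutomatic (R : Set (𝔻.Trace × 𝔻.Trace)) : Prop :=
  (𝔻.foataLanguage R).IsRegular

/-- The identity relation on traces. -/
def idRel : Set (𝔻.Trace × 𝔻.Trace) := {z | z.1 = z.2}

end DependenceAlphabet

/-! ## Pushdown systems over traces -/

/-- A pushdown system with states `Q` and letters `Γ`; `(p, a, w, q) ∈ Δ` is the transition that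
goes from `p` to `q`, reads `a` and writes `w`. (Finiteness of `Q` and `Γ` is assumed
separately.) -/
@[ext]
structure PushdownSystem (Q Γ : Type*) where
  alph : DependenceAlphabet Γ
  Δ : Set (Q × Γ × List Γ × Q)
  finite_Δ : Δ.Finite

namespace PushdownSystem

variable {Q Γ : Type*} (P : PushdownSystem Q Γ)

/-- The one-step relation on configurations. -/
def Step (c d : Q × P.alph.Trace) : Prop :=
  ∃ (a : Γ) (w x : List Γ), (c.1, a, w, d.1) ∈ P.Δ ∧
    c.2 = P.alph.trace (x ++ [a]) ∧ d.2 = P.alph.trace (x ++ w)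

/-- The reachability relation `reach_{p,q}` on traces. -/
def reach (p q : Q) : Set (P.alph.Trace × P.alph.Trace) :=
  {z | Relation.ReflTransGen P.Step (p, z.1) (q, z.2)}

/-- Trace-pushdown systems. -/
structure IsTPDS : Prop where
  /-- `D(w) ⊆ D(a)` for every transition reading `a` and writing `w`. -/
  dep_subset : ∀ p a w q, (p, a, w, q) ∈ P.Δ →
    ∀ b ∈ w, ∀ c, P.alph.Dep b c → P.alph.Dep a c
  /-- Consecutive transitions reading independent letters can be interchanged. -/
  swap : ∀ p a v q b w r, (p, a, v, q) ∈ P.Δ → (q, b, w, r) ∈ P.Δ → P.alph.Indep a b →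
    ∃ q', (p, b, w, q') ∈ P.Δ ∧ (q', a, v, r) ∈ P.Δ

/-- All transitions write the empty word. -/
def WritesEmpty : Prop := ∀ p a w q, (p, a, w, q) ∈ P.Δ → w = []

end PushdownSystem

/-! ## Finite presentations, for the effectiveness claims -/

/-- A finite description of a pushdown system: the number of states, the number of letters, a list
of pairs of letters, and a list of transitions. -/
abbrev PDSCode : Type :=
  ℕ × ℕ × List (ℕ × ℕ) × List (ℕ × ℕ × List ℕ × ℕ)

namespace PDSCode

/-- The number of states. -/
def states (c : PDSCode) : ℕ := c.1

/-- The number of letters. -/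
def letters (c : PDSCode) : ℕ := c.2.1

/-- The described dependence relation: the reflexive and symmetric closure of the given list. -/
def toAlphabet (c : PDSCode) : DependenceAlphabet (Fin c.letters) where
  Dep a b := a = b ∨ (a.val, b.val) ∈ c.2.2.1 ∨ (b.val, a.val) ∈ c.2.2.1
  refl _ := Or.inl rfl
  symm _ _ h := by
    rcases h with h | h | h
    · exact Or.inl h.symm
    · exact Or.inr (Or.inr h)
    · exact Or.inr (Or.inl h)

/-- The described pushdown system, with states `0, …, c.states - 1` and letters
`0, …, c.letters - 1`. Listed transitions that mention other numbers are ignored. -/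
def toPDS (c : PDSCode) : PushdownSystem (Fin c.states) (Fin c.letters) where
  alph := c.toAlphabet
  Δ := {t | (t.1.val, t.2.1.val, t.2.2.1.map Fin.val, t.2.2.2.val) ∈ c.2.2.2}
  finite_Δ := by
    refine Set.Finite.preimage (f := fun t : Fin c.states × Fin c.letters × List (Fin c.letters) ×
      Fin c.states => (t.1.val, t.2.1.val, t.2.2.1.map Fin.val, t.2.2.2.val)) ?_
      (List.finite_toSet c.2.2.2)
    rintro ⟨p, a, w, q⟩ - ⟨p', a', w', q'⟩ - h
    simp only [Prod.mk.injEq] at h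
    obtain ⟨h1, h2, h3, h4⟩ := h
    rw [Fin.ext h1, Fin.ext h2, Fin.ext h4, List.map_injective_iff.2 Fin.val_injective h3]

/-- Every pushdown system over initial segments of the natural numbers has a description. -/
theorem exists_toPDS_eq {n m : ℕ} (P : PushdownSystem (Fin n) (Fin m)) :
    ∃ (d : List (ℕ × ℕ)) (δ : List (ℕ × ℕ × List ℕ × ℕ)), toPDS (n, m, d, δ) = P := by
  classical
  obtain ⟨⟨Dep, hr, hs⟩, Δ, hΔ⟩ := P
  let d : List (ℕ × ℕ) := ((Finset.univ.filter fun t : Fin m × Fin m => Dep t.1 t.2).image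
    fun t => (t.1.val, t.2.val)).toList
  let δ : List (ℕ × ℕ × List ℕ × ℕ) := (hΔ.toFinset.image
    fun t => (t.1.val, t.2.1.val, t.2.2.1.map Fin.val, t.2.2.2.val)).toList
  have hd : ∀ a b : Fin m, (a.val, b.val) ∈ d ↔ Dep a b := by
    intro a b
    simp only [d, Finset.mem_toList, Finset.mem_image, Finset.mem_filter, Finset.mem_univ,
      true_and, Prod.mk.injEq, Prod.exists]
    constructor
    · rintro ⟨a', b', h, h1, h2⟩
      rwa [← Fin.ext h1, ← Fin.ext h2]
    · exact fun h => ⟨a, b, h, rfl, rfl⟩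
  have hδ : ∀ (p : Fin n) (a : Fin m) (w : List (Fin m)) (q : Fin n),
      (p.val, a.val, w.map Fin.val, q.val) ∈ δ ↔ (p, a, w, q) ∈ Δ := by
    intro p a w q
    simp only [δ, Finset.mem_toList, Finset.mem_image, Set.Finite.mem_toFinset,
      Prod.mk.injEq, Prod.exists]
    constructor
    · rintro ⟨p', a', w', q', h, h1, h2, h3, h4⟩
      rwa [← Fin.ext h1, ← Fin.ext h2, ← Fin.ext h4,
        ← List.map_injective_iff.2 Fin.val_injective h3]
    · exact fun h => ⟨p, a, w, q, h, rfl, rfl, rfl, rfl⟩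
  refine ⟨d, δ, ?_⟩
  have h1 : toAlphabet (n, m, d, δ) = ⟨Dep, hr, hs⟩ := by
    have : ∀ a b : Fin m, (a = b ∨ (a.val, b.val) ∈ d ∨ (b.val, a.val) ∈ d) = Dep a b := by
      intro a b
      rw [hd, hd]
      refine propext ⟨?_, fun h => Or.inr (Or.inl h)⟩
      rintro (rfl | h | h)
      exacts [hr _, h, hs _ _ h]
    exact DependenceAlphabet.ext (funext fun a => funext fun b => this a b)
  exact PushdownSystem.ext h1 (Set.ext fun ⟨p, a, w, q⟩ => hδ p a w q)

end PDSCode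

/-- A finite description of an NFA with letters described by elements of `β`: the number of
states, the list of initial states, the list of transitions, the list of final states. -/
abbrev NFACode (β : Type) : Type :=
  ℕ × List ℕ × List (ℕ × β × ℕ) × List ℕ

namespace NFACode

/-- The described NFA, with states `0, …, c.1 - 1`, where `den b a` says that `b` describes the
letter `a`. -/
def toNFA {α : Type*} {β : Type} (den : β → α → Prop) (c : NFACode β) : NFA α (Fin c.1) where
  start := {s | s.val ∈ c.2.1}
  step s a := {t | ∃ b, den b a ∧ (s.val, b, t.val) ∈ c.2.2.1}
  accept := {s | s.val ∈ c.2.2.2}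

end NFACode

/-- The number `b` describes the letter `b` of `Fin m`. -/
def DenotesLetter {m : ℕ} (b : ℕ) (a : Fin m) : Prop := a.val = b

/-- The pair of lists `b` describes the pair `A` of independent sets if the lists enumerate
them. -/
def DenotesPair {m : ℕ} (𝔻 : DependenceAlphabet (Fin m)) (b : List ℕ × List ℕ)
    (A : 𝔻.IndepSet × 𝔻.IndepSet) : Prop :=
  A.1.1.image Fin.val = b.1.toFinset ∧ A.2.1.image Fin.val = b.2.toFinset

/-!
Popping commutes with trace equality: by (P2), the steps popping two independent letters can be
exchanged, so whether a word can be popped from `p` to `q` depends only on the trace it represents.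
The set `K` consists of the traces that can be popped; the automaton that pops the letters one by
one recognizes it, and since nothing is ever written, `(p, s) ⊢* (q, t)` says that `s = t * y` with
`y ∈ K`.

For normal forms, let `A₁ ⋯ Aₙ` and `B₁ ⋯ Bₙ` be the extended Foata normal forms of `s` and `t`,
padded by empty sets. The first set of a normal form contains exactly the letters that can be
extracted on the left, so cancelling it shows that `t` divides `s` on the left iff `Bᵢ ⊆ Aᵢ` for
all `i` and every letter of `Aᵢ \ Bᵢ` is independent of all later `Bⱼ`. The cofactor is then
`[A₁ \ B₁] ⋯ [Aₙ \ Bₙ]`. A finite automaton verifies both conditions, remembering the letters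
missing so far, and pops the cofactor at the same time.
-/

namespace DependenceAlphabet

variable {Γ : Type*} {𝔻 : DependenceAlphabet Γ}

/-! ### Cancellation and divisibility in the trace monoid -/

theorem Indep.symm {a b : Γ} (h : 𝔻.Indep a b) : 𝔻.Indep b a :=
  ⟨h.1.symm, fun h' => h.2 (𝔻.symm _ _ h')⟩

theorem indep_iff_not_dep {a b : Γ} : 𝔻.Indep a b ↔ ¬ 𝔻.Dep a b :=
  ⟨And.right, fun h => ⟨fun e => h (e ▸ 𝔻.refl a), h⟩⟩

theorem trace_nil : 𝔻.trace [] = 1 := rfl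

theorem trace_append (u v : List Γ) : 𝔻.trace (u ++ v) = 𝔻.trace u * 𝔻.trace v :=
  map_mul (PresentedMonoid.mk 𝔻.SwapRel) (FreeMonoid.ofList u) (FreeMonoid.ofList v)

theorem trace_cons (a : Γ) (w : List Γ) : 𝔻.trace (a :: w) = 𝔻.trace [a] * 𝔻.trace w :=
  trace_append [a] w

theorem trace_eq_prod_map (w : List Γ) : 𝔻.trace w = (w.map fun a => 𝔻.trace [a]).prod := by
  induction w with
  | nil => rfl
  | cons a w ih => rw [trace_cons, ih, List.map_cons, List.prod_cons]

theorem trace_surjective : Function.Surjective 𝔻.trace := fun x => by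
  obtain ⟨w, rfl⟩ := PresentedMonoid.surjective_mk x
  exact ⟨FreeMonoid.toList w, rfl⟩

theorem trace_append_swap {a b : Γ} (h : 𝔻.Indep a b) (u v : List Γ) :
    𝔻.trace (u ++ a :: b :: v) = 𝔻.trace (u ++ b :: a :: v) := by
  rw [trace_append, trace_append, trace_cons a (b :: v), trace_cons b v,
    (𝔻.commute_of_indep h).left_comm, ← trace_cons a v, ← trace_cons b (a :: v)]

theorem apply_eq_of_trace_eq {X : Sort*} (f : List Γ → X)
    (hf : ∀ u v a b, 𝔻.Indep a b → f (u ++ a :: b :: v) = f (u ++ b :: a :: v))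
    {u v : List Γ} (h : 𝔻.trace u = 𝔻.trace v) : f u = f v := by
  let c : Con (FreeMonoid Γ) :=
    { r := fun u v => ∀ s t, f (s ++ u.toList ++ t) = f (s ++ v.toList ++ t)
      iseqv := ⟨fun _ _ _ => rfl, fun h s t => (h s t).symm, fun h h' s t => (h s t).trans (h' s t)⟩
      mul' := fun {u u' v v'} h h' s t => by
        have hv := h' (s ++ u.toList) t
        have hu := h s (v'.toList ++ t)
        simp only [FreeMonoid.toList_mul, List.append_assoc] at hu hv ⊢
        exact hv.trans hu }
  have hc : conGen 𝔻.SwapRel ≤ c := Con.conGen_le.2 <| by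
    rintro _ _ ⟨a, b, hab⟩ s t
    simpa using hf s t a b hab
  simpa using hc ((Con.eq _).1 h) [] []

/-- The word `w` has an occurrence of `a` that commutes with everything before it, so that `a` can
be moved to the front of `w`. -/
def IsInitial (𝔻 : DependenceAlphabet Γ) (a : Γ) : List Γ → Prop
  | [] => False
  | b :: w => b = a ∨ 𝔻.Indep b a ∧ IsInitial 𝔻 a w

theorem isInitial_append {a : Γ} {u v : List Γ} :
    𝔻.IsInitial a (u ++ v) ↔ 𝔻.IsInitial a u ∨ (∀ b ∈ u, 𝔻.Indep b a) ∧ 𝔻.IsInitial a v := by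
  induction u with
  | nil => simp [IsInitial]
  | cons c u ih =>
    simp only [List.cons_append, IsInitial, ih, List.forall_mem_cons]
    tauto

theorem isInitial_congr {a : Γ} {u v : List Γ} (h : 𝔻.trace u = 𝔻.trace v) :
    𝔻.IsInitial a u ↔ 𝔻.IsInitial a v := by
  refine (apply_eq_of_trace_eq (𝔻.IsInitial a) (fun u v b c hbc => ?_) h).to_iff
  have hswap : 𝔻.IsInitial a (b :: c :: v) ↔ 𝔻.IsInitial a (c :: b :: v) := by
    have hcb := hbc.symm
    simp only [IsInitial]
    grind
  simp only [isInitial_append, hswap]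

theorem trace_singleton_dvd_trace_iff {a : Γ} {w : List Γ} :
    𝔻.trace [a] ∣ 𝔻.trace w ↔ 𝔻.IsInitial a w := by
  constructor
  · rintro ⟨x, hx⟩
    obtain ⟨v, rfl⟩ := trace_surjective x
    exact (isInitial_congr (hx.trans (trace_cons a v).symm)).2 (Or.inl rfl)
  · induction w with
    | nil => exact False.elim
    | cons b w ih =>
      rintro (rfl | ⟨hba, hw⟩)
      · exact ⟨_, trace_cons b w⟩
      · obtain ⟨x, hx⟩ := ih hw
        exact ⟨𝔻.trace [b] * x,
          by rw [trace_cons, hx, (𝔻.commute_of_indep hba).left_comm]⟩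

theorem not_trace_singleton_dvd_one (a : Γ) : ¬ 𝔻.trace [a] ∣ 1 :=
  fun h => trace_singleton_dvd_trace_iff.1 (h : 𝔻.trace [a] ∣ 𝔻.trace [])

theorem trace_singleton_dvd_trace_mul_iff {a : Γ} {w : List Γ} {x : 𝔻.Trace} :
    𝔻.trace [a] ∣ 𝔻.trace w * x ↔
      𝔻.trace [a] ∣ 𝔻.trace w ∨ (∀ b ∈ w, 𝔻.Indep b a) ∧ 𝔻.trace [a] ∣ x := by
  obtain ⟨v, rfl⟩ := trace_surjective x
  simp only [← trace_append, trace_singleton_dvd_trace_iff, isInitial_append]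

theorem trace_dvd_of_pairwise_indep {w : List Γ} (hw : w.Pairwise 𝔻.Indep) {x : 𝔻.Trace}
    (h : ∀ a ∈ w, 𝔻.trace [a] ∣ x) : 𝔻.trace w ∣ x := by
  induction w generalizing x with
  | nil => exact one_dvd x
  | cons a w ih =>
    rw [List.pairwise_cons] at hw
    obtain ⟨y, rfl⟩ := h a List.mem_cons_self
    rw [trace_cons]
    refine mul_dvd_mul_left _ (ih hw.2 fun b hb => ?_)
    rcases trace_singleton_dvd_trace_mul_iff.1 (h b (List.mem_cons_of_mem _ hb)) with hba | hby
    · rcases trace_singleton_dvd_trace_iff.1 hba with rfl | ⟨-, hnil⟩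
      exacts [absurd rfl (hw.1 _ hb).1, hnil.elim]
    · exact hby.2

theorem trace_erase_congr [DecidableEq Γ] (a : Γ) {u v : List Γ} (h : 𝔻.trace u = 𝔻.trace v) :
    𝔻.trace (u.erase a) = 𝔻.trace (v.erase a) := by
  refine apply_eq_of_trace_eq (fun w => 𝔻.trace (w.erase a)) (fun u v b c hbc => ?_) h
  by_cases hu : a ∈ u
  · simpa only [List.erase_append_left _ hu] using trace_append_swap hbc _ _
  simp only [List.erase_append_right _ hu]
  rcases eq_or_ne b a with rfl | hb
  · simp [hbc.1.symm]
  rcases eq_or_ne c a with rfl | hc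
  · simp [hb]
  · simpa [hb, hc] using trace_append_swap hbc u (v.erase a)

instance : IsLeftCancelMul 𝔻.Trace where
  mul_left_cancel s x y h := by
    classical
    obtain ⟨w, rfl⟩ := trace_surjective s
    obtain ⟨u, rfl⟩ := trace_surjective x
    obtain ⟨v, rfl⟩ := trace_surjective y
    induction w with
    | nil => exact h
    | cons a w ih =>
      refine ih ?_
      have hcons : 𝔻.trace (a :: (w ++ u)) = 𝔻.trace (a :: (w ++ v)) := by
        simpa only [← trace_append, List.cons_append] using h
      simpa only [List.erase_cons_head, trace_append] using trace_erase_congr a hcons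

/-! ### Independent sets and Foata normal forms -/

theorem IndepSet.pairwise_of_nodup (A : 𝔻.IndepSet) {w : List Γ} (hw : w.Nodup)
    (h : ∀ a ∈ w, a ∈ A.1) : w.Pairwise 𝔻.Indep :=
  hw.imp_of_mem fun ha hb hab => A.2 (h _ ha) (h _ hb) hab

theorem IndepSet.trace_eq_of_nodup (A : 𝔻.IndepSet) {w : List Γ} (hw : w.Nodup)
    (h : ∀ a, a ∈ w ↔ a ∈ A.1) : A.trace = 𝔻.trace w := by
  classical
  obtain ⟨A, hA⟩ := A
  obtain rfl : w.toFinset = A := Finset.ext fun a => List.mem_toFinset.trans (h a)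
  rw [trace_eq_prod_map]
  exact Finset.noncommProd_toFinset w _ _ hw

theorem IndepSet.trace_eq (A : 𝔻.IndepSet) : A.trace = 𝔻.trace A.1.toList :=
  A.trace_eq_of_nodup A.1.nodup_toList fun _ => Finset.mem_toList

theorem IndepSet.trace_dvd (A : 𝔻.IndepSet) {x : 𝔻.Trace} (h : ∀ a ∈ A.1, 𝔻.trace [a] ∣ x) :
    A.trace ∣ x := by
  rw [A.trace_eq]
  exact trace_dvd_of_pairwise_indep
    (A.pairwise_of_nodup A.1.nodup_toList fun _ => Finset.mem_toList.1)
    fun a ha => h a (Finset.mem_toList.1 ha)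

theorem IndepSet.trace_singleton_dvd_mul_iff (A : 𝔻.IndepSet) {a : Γ} {x : 𝔻.Trace} :
    𝔻.trace [a] ∣ A.trace * x ↔ a ∈ A.1 ∨ (∀ b ∈ A.1, 𝔻.Indep b a) ∧ 𝔻.trace [a] ∣ x := by
  have key : ∀ w : List Γ, w.Pairwise 𝔻.Indep → (𝔻.IsInitial a w ↔ a ∈ w) := fun w hw => by
    induction w with
    | nil => simp [IsInitial]
    | cons b w ih =>
      rw [List.pairwise_cons] at hw
      simp only [IsInitial, ih hw.2, List.mem_cons, eq_comm (a := a)]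
      exact or_congr_right (and_iff_right_of_imp (hw.1 a))
  rw [A.trace_eq, trace_singleton_dvd_trace_mul_iff, trace_singleton_dvd_trace_iff,
    key _ (A.pairwise_of_nodup A.1.nodup_toList fun _ => Finset.mem_toList.1)]
  simp only [Finset.mem_toList]

theorem IndepSet.commute_trace {A B : 𝔻.IndepSet} (h : ∀ a ∈ A.1, ∀ b ∈ B.1, 𝔻.Indep a b) :
    Commute A.trace B.trace :=
  Finset.noncommProd_commute _ _ _ _ fun b hb => Commute.symm <|
    Finset.noncommProd_commute _ _ _ _ fun a ha => 𝔻.commute_of_indep (h a ha b hb).symm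

open Classical in
/-- The set difference of independent sets. -/
noncomputable def IndepSet.diff (A B : 𝔻.IndepSet) : 𝔻.IndepSet :=
  ⟨A.1 \ B.1, A.2.mono (Finset.coe_subset.2 Finset.sdiff_subset)⟩

theorem IndepSet.mem_diff {A B : 𝔻.IndepSet} {a : Γ} :
    a ∈ (A.diff B).1 ↔ a ∈ A.1 ∧ a ∉ B.1 := by
  classical exact Finset.mem_sdiff

theorem IndepSet.trace_mul_trace_diff {A B : 𝔻.IndepSet} (h : B.1 ⊆ A.1) :
    B.trace * (A.diff B).trace = A.trace := by
  rw [B.trace_eq, (A.diff B).trace_eq, ← trace_append]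
  refine (A.trace_eq_of_nodup (List.nodup_append.2 ⟨B.1.nodup_toList, Finset.nodup_toList _, ?_⟩)
    fun a => ?_).symm
  · rintro a ha _ hb rfl
    exact (mem_diff.1 (Finset.mem_toList.1 hb)).2 (Finset.mem_toList.1 ha)
  · simp only [List.mem_append, Finset.mem_toList, mem_diff]
    have := @h a
    tauto

theorem foataTrace_nil : 𝔻.foataTrace [] = 1 := rfl

theorem foataTrace_cons (A : 𝔻.IndepSet) (W : List 𝔻.IndepSet) :
    𝔻.foataTrace (A :: W) = A.trace * 𝔻.foataTrace W := List.prod_cons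

theorem commute_foataTrace {A : 𝔻.IndepSet} {W : List 𝔻.IndepSet}
    (h : ∀ B ∈ W, ∀ a ∈ A.1, ∀ b ∈ B.1, 𝔻.Indep a b) : Commute A.trace (𝔻.foataTrace W) :=
  Commute.list_prod_right _ _ <| List.forall_mem_map.2 fun B hB => IndepSet.commute_trace (h B hB)

theorem trace_singleton_dvd_foataTrace_mul_iff {a : Γ} {W : List 𝔻.IndepSet} {x : 𝔻.Trace} :
    𝔻.trace [a] ∣ 𝔻.foataTrace W * x ↔ 𝔻.trace [a] ∣ 𝔻.foataTrace W ∨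
      (∀ B ∈ W, ∀ b ∈ B.1, 𝔻.Indep b a) ∧ 𝔻.trace [a] ∣ x := by
  induction W with
  | nil => simp [foataTrace_nil, not_trace_singleton_dvd_one]
  | cons A W ih =>
    simp only [foataTrace_cons, mul_assoc, A.trace_singleton_dvd_mul_iff, ih, List.forall_mem_cons]
    tauto

theorem IsExtendedFoata.tail {A : 𝔻.IndepSet} {W : List 𝔻.IndepSet}
    (h : 𝔻.IsExtendedFoata (A :: W)) : 𝔻.IsExtendedFoata W :=
  List.IsChain.tail h

theorem IsExtendedFoata.trace_singleton_dvd_iff {A : 𝔻.IndepSet} {W : List 𝔻.IndepSet}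
    (h : 𝔻.IsExtendedFoata (A :: W)) {a : Γ} :
    𝔻.trace [a] ∣ 𝔻.foataTrace (A :: W) ↔ a ∈ A.1 := by
  rw [foataTrace_cons, A.trace_singleton_dvd_mul_iff, or_iff_left_iff_imp]
  rintro ⟨hA, ha⟩
  induction W generalizing A with
  | nil => exact (not_trace_singleton_dvd_one a ha).elim
  | cons B W ih =>
    rw [foataTrace_cons, B.trace_singleton_dvd_mul_iff] at ha
    have haB : a ∈ B.1 := ha.elim id fun ⟨hB, haW⟩ => ih h.tail hB haW
    obtain ⟨b, hb, hdep⟩ := (List.isChain_cons_cons.1 h).1 a haB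
    exact absurd hdep (hA b hb).2

/-! ### Prefixes in extended Foata normal form -/

/-- The condition on a pair of Foata normal forms saying that the second trace is a prefix of the
first: the second set of each pair is contained in the first one, and the letters missing in it are
independent of the second sets of all later pairs. -/
def IsPrefixPair (W : List (𝔻.IndepSet × 𝔻.IndepSet)) : Prop :=
  (∀ x ∈ W, x.2.1 ⊆ x.1.1) ∧
    W.Pairwise fun x y => ∀ a ∈ (x.1.diff x.2).1, ∀ b ∈ y.2.1, 𝔻.Indep a b

theorem isPrefixPair_cons {x : 𝔻.IndepSet × 𝔻.IndepSet} {W : List (𝔻.IndepSet × 𝔻.IndepSet)} :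
    IsPrefixPair (x :: W) ↔ x.2.1 ⊆ x.1.1 ∧
      (∀ y ∈ W, ∀ a ∈ (x.1.diff x.2).1, ∀ b ∈ y.2.1, 𝔻.Indep a b) ∧ IsPrefixPair W := by
  simp only [IsPrefixPair, List.forall_mem_cons, List.pairwise_cons]
  tauto

/-- The product of the letters missing in the second sets: the right factor that turns the second
trace of a prefix pair into the first one. -/
noncomputable def remainder (W : List (𝔻.IndepSet × 𝔻.IndepSet)) : 𝔻.Trace :=
  𝔻.foataTrace (W.map fun x => x.1.diff x.2)

theorem remainder_cons (x : 𝔻.IndepSet × 𝔻.IndepSet) (W : List (𝔻.IndepSet × 𝔻.IndepSet)) :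
    remainder (x :: W) = (x.1.diff x.2).trace * remainder W := List.prod_cons

theorem IsPrefixPair.foataTrace_eq {W : List (𝔻.IndepSet × 𝔻.IndepSet)} (hW : IsPrefixPair W) :
    𝔻.foataTrace (W.map Prod.fst) = 𝔻.foataTrace (W.map Prod.snd) * remainder W := by
  induction W with
  | nil => rfl
  | cons x W ih =>
    obtain ⟨hsub, hindep, hW⟩ := isPrefixPair_cons.1 hW
    have hcomm : Commute (x.1.diff x.2).trace (𝔻.foataTrace (W.map Prod.snd)) :=
      commute_foataTrace (List.forall_mem_map.2 hindep)
    simp only [List.map_cons, foataTrace_cons, remainder_cons, ih hW, mul_assoc,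
      ← IndepSet.trace_mul_trace_diff hsub, hcomm.left_comm]

theorem isPrefixPair_and_eq_remainder {W : List (𝔻.IndepSet × 𝔻.IndepSet)}
    (hfst : 𝔻.IsExtendedFoata (W.map Prod.fst)) (hsnd : 𝔻.IsExtendedFoata (W.map Prod.snd))
    {y : 𝔻.Trace} (h : 𝔻.foataTrace (W.map Prod.fst) = 𝔻.foataTrace (W.map Prod.snd) * y) :
    IsPrefixPair W ∧ y = remainder W := by
  induction W generalizing y with
  | nil => exact ⟨⟨by simp, List.Pairwise.nil⟩, by simpa [foataTrace_nil, remainder] using h.symm⟩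
  | cons x W ih =>
    obtain ⟨A, B⟩ := x
    simp only [List.map_cons] at hfst hsnd h
    have hsub : B.1 ⊆ A.1 := fun b hb => hfst.trace_singleton_dvd_iff.1 <|
      h ▸ (hsnd.trace_singleton_dvd_iff.2 hb).mul_right y
    rw [foataTrace_cons, foataTrace_cons, ← IndepSet.trace_mul_trace_diff hsub, mul_assoc,
      mul_assoc] at h
    replace h := mul_left_cancel h
    have hdiff : ∀ a ∈ (A.diff B).1, (∀ C ∈ W.map Prod.snd, ∀ b ∈ C.1, 𝔻.Indep b a) ∧
        𝔻.trace [a] ∣ y := by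
      intro a ha
      obtain ⟨haA, haB⟩ := IndepSet.mem_diff.1 ha
      have hdvd : 𝔻.trace [a] ∣ 𝔻.foataTrace (W.map Prod.snd) * y :=
        h ▸ (A.diff B).trace_singleton_dvd_mul_iff.2 (Or.inl ha)
      refine (trace_singleton_dvd_foataTrace_mul_iff.1 hdvd).resolve_left fun hW => haB ?_
      have hB : ∀ b ∈ B.1, 𝔻.Indep b a := fun b hb =>
        A.2 (hsub hb) haA (ne_of_mem_of_not_mem hb haB)
      rw [← hsnd.trace_singleton_dvd_iff, foataTrace_cons]
      exact B.trace_singleton_dvd_mul_iff.2 (Or.inr ⟨hB, hW⟩)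
    have hindep : ∀ C ∈ W.map Prod.snd, ∀ a ∈ (A.diff B).1, ∀ b ∈ C.1, 𝔻.Indep a b :=
      fun C hC a ha b hb => ((hdiff a ha).1 C hC b hb).symm
    obtain ⟨z, rfl⟩ := (A.diff B).trace_dvd fun a ha => (hdiff a ha).2
    rw [(commute_foataTrace hindep).symm.left_comm] at h
    obtain ⟨hW, rfl⟩ := ih hfst.tail hsnd.tail (mul_left_cancel h)
    refine ⟨isPrefixPair_cons.2 ⟨hsub, List.forall_mem_map.1 hindep, hW⟩, ?_⟩
    rw [remainder_cons]

end DependenceAlphabet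

section Automata

/-! ### Nondeterministic finite automata -/

variable {α β σ τ : Type*}

theorem isRegular_accepts [Finite σ] (M : NFA α σ) : M.accepts.IsRegular := by
  have := Fintype.ofFinite (Set σ)
  exact Language.isRegular_iff.2 ⟨Set σ, inferInstance, M.toDFA, M.toDFA_correct⟩

theorem mem_acceptsFrom_iff_exists {M : NFA α σ} {S : Set σ} {w : List α} :
    w ∈ M.acceptsFrom S ↔ ∃ s ∈ S, w ∈ M.acceptsFrom {s} := by
  simp only [NFA.mem_acceptsFrom, NFA.mem_evalFrom_iff_exists (S := S)]
  tauto

theorem mem_accepts_iff_exists {M : NFA α σ} {w : List α} :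
    w ∈ M.accepts ↔ ∃ s ∈ M.start, w ∈ M.acceptsFrom {s} := by
  rw [NFA.accepts_eq_acceptsFrom_start, mem_acceptsFrom_iff_exists]

theorem nil_mem_acceptsFrom_singleton {M : NFA α σ} {s : σ} :
    [] ∈ M.acceptsFrom {s} ↔ s ∈ M.accept := by
  simp [NFA.nil_mem_acceptsFrom]

theorem cons_mem_acceptsFrom_singleton {M : NFA α σ} {s : σ} {a : α} {w : List α} :
    a :: w ∈ M.acceptsFrom {s} ↔ ∃ t ∈ M.step s a, w ∈ M.acceptsFrom {t} := by
  rw [NFA.cons_mem_acceptsFrom, NFA.stepSet_singleton, mem_acceptsFrom_iff_exists]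

theorem accepts_eq_of_biTotal {M : NFA α σ} {N : NFA α τ} {R : σ → τ → Prop}
    (hR : Relator.BiTotal R) (hstart : ∀ s t, R s t → (s ∈ M.start ↔ t ∈ N.start))
    (hstep : ∀ s t s' t' a, R s t → R s' t' → (s' ∈ M.step s a ↔ t' ∈ N.step t a))
    (haccept : ∀ s t, R s t → (s ∈ M.accept ↔ t ∈ N.accept)) : M.accepts = N.accepts := by
  have key (w : List α) : ∀ s t, R s t → (w ∈ M.acceptsFrom {s} ↔ w ∈ N.acceptsFrom {t}) := by
    induction w with
    | nil => simpa only [nil_mem_acceptsFrom_singleton] using haccept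
    | cons a w ih =>
      intro s t hst
      simp only [cons_mem_acceptsFrom_singleton]
      exact hR.rel_exists fun s' t' h => and_congr (hstep s t s' t' a hst h) (ih s' t' h)
  ext w
  simp only [mem_accepts_iff_exists]
  exact hR.rel_exists fun s t h => and_congr (hstart s t h) (key w s t h)

theorem mem_accepts_iff_of_recursion {M : NFA α σ} {p : σ → List α → Prop}
    (hnil : ∀ s, p s [] ↔ s ∈ M.accept)
    (hcons : ∀ s a w, p s (a :: w) ↔ ∃ t ∈ M.step s a, p t w) {w : List α} :
    w ∈ M.accepts ↔ ∃ s ∈ M.start, p s w := by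
  have key : ∀ s, w ∈ M.acceptsFrom {s} ↔ p s w := by
    induction w with
    | nil => exact fun s => by rw [nil_mem_acceptsFrom_singleton, hnil]
    | cons a w ih => exact fun s => by simp only [cons_mem_acceptsFrom_singleton, hcons, ih]
  simp only [mem_accepts_iff_exists, key]

/-- The automaton that runs `M` on the images of the letters under `f`. -/
def comapNFA (f : α → β) (M : NFA β σ) : NFA α σ where
  start := M.start
  step s a := M.step s (f a)
  accept := M.accept

theorem mem_accepts_comapNFA {f : α → β} {M : NFA β σ} {w : List α} :
    w ∈ (comapNFA f M).accepts ↔ w.map f ∈ M.accepts := by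
  rw [mem_accepts_iff_of_recursion (p := fun s w => w.map f ∈ M.acceptsFrom {s})
    (fun _ => nil_mem_acceptsFrom_singleton) fun _ _ _ => cons_mem_acceptsFrom_singleton]
  exact (mem_accepts_iff_exists (M := M)).symm

/-- The product automaton, which runs `M` and `N` in parallel. -/
def interNFA (M : NFA α σ) (N : NFA α τ) : NFA α (σ × τ) where
  start := M.start ×ˢ N.start
  step s a := M.step s.1 a ×ˢ N.step s.2 a
  accept := M.accept ×ˢ N.accept

theorem mem_accepts_interNFA {M : NFA α σ} {N : NFA α τ} {w : List α} :
    w ∈ (interNFA M N).accepts ↔ w ∈ M.accepts ∧ w ∈ N.accepts := by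
  rw [mem_accepts_iff_of_recursion
    (p := fun s w => w ∈ M.acceptsFrom {s.1} ∧ w ∈ N.acceptsFrom {s.2})]
  · simp only [mem_accepts_iff_exists, interNFA, Set.mem_prod, Prod.exists]
    tauto
  · exact fun s => and_congr nil_mem_acceptsFrom_singleton nil_mem_acceptsFrom_singleton
  · intro s a w
    simp only [cons_mem_acceptsFrom_singleton, interNFA, Set.mem_prod, Prod.exists]
    tauto

/-- The automaton that checks that consecutive letters are related by `R`; its state is the last
letter read. For reflexive `R` every state can serve as an initial state. -/
def chainNFA (R : α → α → Prop) : NFA α α where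
  start := Set.univ
  step a b := {c | c = b ∧ R a b}
  accept := Set.univ

theorem mem_accepts_chainNFA [Nonempty α] {R : α → α → Prop} [Std.Refl R] {w : List α} :
    w ∈ (chainNFA R).accepts ↔ w.IsChain R := by
  rw [mem_accepts_iff_of_recursion (p := fun a w => (a :: w).IsChain R)]
  · refine ⟨fun ⟨a, _, h⟩ => h.tail, fun h => ?_⟩
    cases w with
    | nil => exact ⟨Classical.arbitrary α, trivial, .singleton _⟩
    | cons b w => exact ⟨b, trivial, .cons_cons (refl_of R b) h⟩
  · exact fun a => iff_of_true (.singleton a) trivial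
  · simp [chainNFA, and_assoc]

end Automata

namespace PushdownSystem

open DependenceAlphabet

variable {Q Γ : Type*} {P : PushdownSystem Q Γ}

/-! ### Popping words and traces -/

/-- The transitions that write the empty word lead from `p` to `q` while removing the word from
right to left. -/
def PopPath (P : PushdownSystem Q Γ) (p : Q) : List Γ → Q → Prop
  | [], q => p = q
  | a :: w, q => ∃ r, P.PopPath p w r ∧ (r, a, [], q) ∈ P.Δ

theorem popPath_append {p q : Q} {u v : List Γ} :
    P.PopPath p (u ++ v) q ↔ ∃ r, P.PopPath p v r ∧ P.PopPath r u q := by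
  induction u generalizing q with
  | nil => simp [PopPath]
  | cons a u ih =>
    simp only [List.cons_append, PopPath, ih]
    grind

theorem PopPath.swap (hP : P.IsTPDS) {p q : Q} {a b : Γ} {w : List Γ} (hab : P.alph.Indep a b) :
    P.PopPath p (a :: b :: w) q → P.PopPath p (b :: a :: w) q := by
  rintro ⟨r, ⟨s, hw, hb⟩, ha⟩
  obtain ⟨r', ha', hb'⟩ := hP.swap s b [] r a [] q hb ha hab.symm
  exact ⟨r', ⟨s, hw, ha'⟩, hb'⟩

theorem popPath_congr (hP : P.IsTPDS) {p q : Q} {u v : List Γ}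
    (h : P.alph.trace u = P.alph.trace v) : P.PopPath p u q ↔ P.PopPath p v q := by
  refine (apply_eq_of_trace_eq (P.PopPath p · q) (fun u v a b hab => ?_) h).to_iff
  simp only [popPath_append]
  exact propext <| exists_congr fun r => and_congr_left' ⟨.swap hP hab, .swap hP hab.symm⟩

/-- The traces that can be popped on the way from `p` to `q`: the set `𝒦` of the theorem. -/
def popSet (P : PushdownSystem Q Γ) (p q : Q) : Set P.alph.Trace :=
  P.alph.trace '' {w | P.PopPath p w q}

theorem trace_mem_popSet (hP : P.IsTPDS) {p q : Q} {w : List Γ} :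
    P.alph.trace w ∈ P.popSet p q ↔ P.PopPath p w q :=
  ⟨fun ⟨_, hv, h⟩ => (popPath_congr hP h).1 hv, fun h => ⟨w, h, rfl⟩⟩

theorem trace_singleton_mem_popSet (hP : P.IsTPDS) {p q : Q} {a : Γ} :
    P.alph.trace [a] ∈ P.popSet p q ↔ (p, a, [], q) ∈ P.Δ := by
  simp [trace_mem_popSet hP, PopPath]

theorem one_mem_popSet (hP : P.IsTPDS) {p q : Q} : 1 ∈ P.popSet p q ↔ p = q :=
  trace_mem_popSet hP (w := [])

theorem mul_mem_popSet (hP : P.IsTPDS) {p q : Q} {x y : P.alph.Trace} :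
    x * y ∈ P.popSet p q ↔ ∃ r, y ∈ P.popSet p r ∧ x ∈ P.popSet r q := by
  obtain ⟨u, rfl⟩ := trace_surjective x
  obtain ⟨v, rfl⟩ := trace_surjective y
  simp only [← trace_append, trace_mem_popSet hP, popPath_append]

theorem mem_reach_iff (hP : P.IsTPDS) (hE : P.WritesEmpty) {p q : Q} {s t : P.alph.Trace} :
    (s, t) ∈ P.reach p q ↔ ∃ y ∈ P.popSet p q, s = t * y := by
  constructor
  · intro h
    change Relation.ReflTransGen P.Step (p, s) (q, t) at h
    generalize hc : (p, s) = c at h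
    induction h using Relation.ReflTransGen.head_induction_on generalizing p s with
    | refl =>
      obtain ⟨rfl, rfl⟩ := Prod.mk.inj hc
      exact ⟨1, (one_mem_popSet hP).2 rfl, (mul_one _).symm⟩
    | @head c c' hstep _ ih =>
      obtain ⟨r, s'⟩ := c'
      subst hc
      obtain ⟨a, w, x, hΔ, hs, hs'⟩ := hstep
      obtain rfl := hE _ _ _ _ hΔ
      obtain ⟨y, hy, rfl⟩ := ih rfl
      refine ⟨y * P.alph.trace [a],
        (mul_mem_popSet hP).2 ⟨r, (trace_singleton_mem_popSet hP).2 hΔ, hy⟩, ?_⟩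
      simp only [List.append_nil, trace_append] at hs hs'
      rw [hs, ← hs', mul_assoc]
  · rintro ⟨_, ⟨w, hw, rfl⟩, rfl⟩
    induction w generalizing q t with
    | nil =>
      obtain rfl : p = q := hw
      rw [trace_nil, mul_one]
      exact Relation.ReflTransGen.refl
    | cons a w ih =>
      obtain ⟨r, hw, hΔ⟩ := hw
      obtain ⟨x, rfl⟩ := trace_surjective t
      rw [trace_cons, ← mul_assoc]
      exact Relation.ReflTransGen.tail (ih hw)
        ⟨a, [], x, hΔ, (trace_append x [a]).symm, by rw [List.append_nil]⟩

theorem reach_eq (hP : P.IsTPDS) (hE : P.WritesEmpty) (p q : Q) :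
    P.reach p q = P.alph.idRel * (P.popSet p q ×ˢ {1}) := by
  ext ⟨s, t⟩
  simp only [mem_reach_iff hP hE, Set.mem_mul, Prod.exists, idRel, Set.mem_prod,
    Set.mem_singleton_iff, Set.mem_ofPred_eq, Prod.mk_mul_mk, Prod.mk.injEq]
  constructor
  · rintro ⟨y, hy, rfl⟩
    exact ⟨t, t, rfl, y, 1, ⟨hy, rfl⟩, rfl, mul_one t⟩
  · rintro ⟨x, _, rfl, y, _, ⟨hy, rfl⟩, rfl, rfl⟩
    exact ⟨y, hy, by rw [mul_one]⟩

/-! ### Automata for popping and for reachability -/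

/-- The automaton for the words whose letters, interpreted as traces by `f`, multiply to an
element of `P.popSet p q`. It runs from `q` to `p`, because the last letter of a word is popped
first. -/
def popNFA {β : Type*} (f : β → P.alph.Trace) (p q : Q) : NFA β Q where
  start := {q}
  step r b := {s | f b ∈ P.popSet s r}
  accept := {p}

theorem mem_accepts_popNFA (hP : P.IsTPDS) {β : Type*} {f : β → P.alph.Trace} {p q : Q}
    {w : List β} : w ∈ (popNFA f p q).accepts ↔ (w.map f).prod ∈ P.popSet p q := by
  rw [mem_accepts_iff_of_recursion (p := fun r w => (w.map f).prod ∈ P.popSet p r)]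
  · simp [popNFA]
  · exact fun r => (one_mem_popSet hP).trans eq_comm
  · intro r b w
    simp only [List.map_cons, List.prod_cons, mul_mem_popSet hP, popNFA, Set.mem_ofPred_eq,
      and_comm]

theorem accepts_popNFA_letters (hP : P.IsTPDS) (p q : Q) :
    (popNFA (fun a => P.alph.trace [a]) p q).accepts = {w | P.alph.trace w ∈ P.popSet p q} := by
  ext w
  rw [mem_accepts_popNFA hP, ← trace_eq_prod_map]
  rfl

end PushdownSystem

namespace DependenceAlphabet

variable {Γ : Type*} {𝔻 : DependenceAlphabet Γ}

/-- The relation between consecutive sets in an extended Foata normal form: every letter of `B`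
depends on some letter of `A`. -/
def Covers (𝔻 : DependenceAlphabet Γ) (A B : Finset Γ) : Prop := ∀ b ∈ B, ∃ a ∈ A, 𝔻.Dep a b

instance : Std.Refl 𝔻.Covers := ⟨fun _ b hb => ⟨b, hb, 𝔻.refl b⟩⟩

theorem isExtendedFoata_iff_mem_accepts {W : List 𝔻.IndepSet} :
    𝔻.IsExtendedFoata W ↔ W.map Subtype.val ∈ (chainNFA 𝔻.Covers).accepts := by
  rw [mem_accepts_chainNFA, List.isChain_map]
  rfl

/-- The automaton that recognizes prefix pairs. Its state is any set containing all the letters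
that were missing so far, which is easier to encode than the exact set. -/
def prefixNFA (𝔻 : DependenceAlphabet Γ) : NFA (𝔻.IndepSet × 𝔻.IndepSet) (Finset Γ) where
  start := Set.univ
  step S x := {T | x.2.1 ⊆ x.1.1 ∧ S ⊆ T ∧ (x.1.diff x.2).1 ⊆ T ∧
    ∀ a ∈ S, ∀ b ∈ x.2.1, 𝔻.Indep a b}
  accept := Set.univ

theorem mem_accepts_prefixNFA {W : List (𝔻.IndepSet × 𝔻.IndepSet)} :
    W ∈ 𝔻.prefixNFA.accepts ↔ IsPrefixPair W := by
  classical
  rw [mem_accepts_iff_of_recursion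
    (p := fun S W => IsPrefixPair W ∧ ∀ x ∈ W, ∀ a ∈ S, ∀ b ∈ x.2.1, 𝔻.Indep a b)]
  · exact ⟨fun ⟨_, _, h, _⟩ => h, fun h => ⟨∅, trivial, h, by simp⟩⟩
  · exact fun S => iff_of_true ⟨⟨by simp, .nil⟩, by simp⟩ trivial
  · intro S x W
    simp only [isPrefixPair_cons, List.forall_mem_cons]
    constructor
    · rintro ⟨⟨hsub, hdiff, hW⟩, hSx, hS⟩
      refine ⟨S ∪ (x.1.diff x.2).1,
        ⟨hsub, Finset.subset_union_left, Finset.subset_union_right, hSx⟩, hW, fun y hy a ha => ?_⟩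
      exact (Finset.mem_union.1 ha).elim (hS y hy a) (hdiff y hy a)
    · rintro ⟨T, ⟨hsub, hST, hdT, hSx⟩, hW, hT⟩
      exact ⟨⟨hsub, fun y hy a ha => hT y hy a (hdT ha), hW⟩, hSx,
        fun y hy a ha => hT y hy a (hST ha)⟩

end DependenceAlphabet

namespace PushdownSystem

open DependenceAlphabet

variable {Q Γ : Type*} {P : PushdownSystem Q Γ}

/-- The automaton for the language of `reach_{p,q}`: it checks that both words are in extended
Foata normal form, that the second trace is a prefix of the first, and that the remainder can be
popped. -/
noncomputable def reachNFA (P : PushdownSystem Q Γ) (p q : Q) :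
    NFA (P.alph.IndepSet × P.alph.IndepSet) (Finset Γ × Finset Γ × Finset Γ × Q) :=
  interNFA (comapNFA (fun x => x.1.1) (chainNFA P.alph.Covers)) <|
    interNFA (comapNFA (fun x => x.2.1) (chainNFA P.alph.Covers)) <|
      interNFA P.alph.prefixNFA (popNFA (fun x => (x.1.diff x.2).trace) p q)

theorem accepts_reachNFA (hP : P.IsTPDS) (hE : P.WritesEmpty) (p q : Q) :
    (P.reachNFA p q).accepts = P.alph.foataLanguage (P.reach p q) := by
  ext W
  have hfst : W.map (fun x => x.1.1) ∈ (chainNFA P.alph.Covers).accepts ↔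
      P.alph.IsExtendedFoata (W.map Prod.fst) := by
    rw [isExtendedFoata_iff_mem_accepts, List.map_map]; rfl
  have hsnd : W.map (fun x => x.2.1) ∈ (chainNFA P.alph.Covers).accepts ↔
      P.alph.IsExtendedFoata (W.map Prod.snd) := by
    rw [isExtendedFoata_iff_mem_accepts, List.map_map]; rfl
  have hremainder : (W.map fun x => (x.1.diff x.2).trace).prod = remainder W := by
    rw [remainder, foataTrace, List.map_map]; rfl
  simp only [reachNFA, mem_accepts_interNFA, mem_accepts_comapNFA, hfst, hsnd,
    mem_accepts_prefixNFA, mem_accepts_popNFA hP, hremainder]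
  refine and_congr_right fun hW₁ => and_congr_right fun hW₂ => ?_
  rw [mem_reach_iff hP hE]
  constructor
  · exact fun ⟨hpre, hrem⟩ => ⟨remainder W, hrem, hpre.foataTrace_eq⟩
  · rintro ⟨y, hy, h⟩
    obtain ⟨hpre, rfl⟩ := isPrefixPair_and_eq_remainder hW₁ hW₂ h
    exact ⟨hpre, hy⟩

end PushdownSystem

/-! ### Primitive recursive predicates and functions on lists -/

section PrimrecLists

open Primrec

variable {α β γ : Type*} [Primcodable α] [Primcodable β] [Primcodable γ]

theorem primrecPred_forall_mem {f : α → List β} {p : α → β → Prop} (hf : Primrec f)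
    (hp : PrimrecRel p) : PrimrecPred fun a => ∀ b ∈ f a, p a b :=
  (PrimrecRel.forall_mem_list (R := fun b a => p a b) hp.swap).comp hf Primrec.id

theorem primrecPred_exists_mem {f : α → List β} {p : α → β → Prop} (hf : Primrec f)
    (hp : PrimrecRel p) : PrimrecPred fun a => ∃ b ∈ f a, p a b :=
  (PrimrecRel.exists_mem_list (R := fun b a => p a b) hp.swap).comp hf Primrec.id

theorem primrecPred_mem {f : α → β} {g : α → List β} (hf : Primrec f) (hg : Primrec g) :
    PrimrecPred fun a => f a ∈ g a :=
  (primrecPred_exists_mem (p := fun a b => b = f a) hg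
    (Primrec.eq.comp snd (hf.comp fst))).of_eq fun a => by simp

theorem primrecPred_subset {f g : α → List β} (hf : Primrec f) (hg : Primrec g) :
    PrimrecPred fun a => f a ⊆ g a :=
  primrecPred_forall_mem hf (primrecPred_mem snd (hg.comp fst))

theorem primrec_filter {f : α → List β} {p : α → β → Prop} [∀ a, DecidablePred (p a)]
    (hf : Primrec f) (hp : PrimrecRel p) : Primrec fun a => (f a).filter fun b => p a b :=
  letI : DecidableRel fun b a => p a b := fun b a => inferInstanceAs (Decidable (p a b))
  (PrimrecRel.listFilter (R := fun b a => p a b) hp.swap).comp hf Primrec.id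

theorem primrec_product {f : α → List β} {g : α → List γ} (hf : Primrec f) (hg : Primrec g) :
    Primrec fun a => f a ×ˢ g a :=
  list_flatMap hf (list_map (hg.comp fst) ((snd.comp fst).pair snd).to₂).to₂

theorem primrec_sublists : Primrec (List.sublists (α := α)) :=
  list_foldr Primrec.id (const [[]]) <|
    (list_flatMap (snd.comp snd) <| Primrec.to₂ <| list_cons.comp snd <|
      list_cons.comp (list_cons.comp (fst.comp (snd.comp fst)) snd) (const [])).to₂

end PrimrecLists

namespace NFACode

variable {α σ γ : Type*} {β : Type} [DecidableEq γ]

/-! ### Codes of automata with named states -/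

/-- The code of the automaton whose states are the members of `S`, numbered by their positions,
with initial states `I`, transitions `T` and final states `F`. -/
def ofStates (S I : List γ) (T : List (γ × β × γ)) (F : List γ) : NFACode β :=
  (S.length, I.map (S.idxOf ·), T.map fun e => (S.idxOf e.1, e.2.1, S.idxOf e.2.2),
    F.map (S.idxOf ·))

theorem idxOf_eq_iff {S : List γ} (hS : S.Nodup) {x : γ} (i : Fin S.length) :
    S.idxOf x = i ↔ x = S[i] := by
  refine ⟨fun h => ?_, fun h => h ▸ hS.idxOf_getElem i i.isLt⟩
  have hx : S.idxOf x < S.length := h ▸ i.isLt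
  simp only [Fin.getElem_fin, ← h, List.getElem_idxOf hx]

theorem accepts_ofStates {S I F : List γ} {T : List (γ × β × γ)} {den : β → α → Prop}
    {N : NFA α σ} {R : γ → σ → Prop} (hS : S.Nodup) (hleft : ∀ x ∈ S, ∃ s, R x s)
    (hright : ∀ s, ∃ x ∈ S, R x s) (hstart : ∀ x ∈ S, ∀ s, R x s → (x ∈ I ↔ s ∈ N.start))
    (hstep : ∀ x ∈ S, ∀ y ∈ S, ∀ s t a, R x s → R y t →
      ((∃ b, den b a ∧ (x, b, y) ∈ T) ↔ t ∈ N.step s a))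
    (haccept : ∀ x ∈ S, ∀ s, R x s → (x ∈ F ↔ s ∈ N.accept)) :
    ((ofStates S I T F).toNFA den).accepts = N.accepts := by
  have hmem (i : Fin S.length) : S[i] ∈ S := List.getElem_mem i.isLt
  have hidx (L : List γ) (i : Fin S.length) : (i : ℕ) ∈ L.map (S.idxOf ·) ↔ S[i] ∈ L := by
    simp only [List.mem_map, idxOf_eq_iff hS, exists_eq_right]
  refine accepts_eq_of_biTotal (R := fun i : Fin S.length => R S[i]) ⟨fun i => hleft _ (hmem i), ?_⟩
    (fun i s h => (hidx I i).trans (hstart _ (hmem i) s h))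
    (fun (i : Fin S.length) s (j : Fin S.length) t a hi hj => ?_)
    (fun i s h => (hidx F i).trans (haccept _ (hmem i) s h))
  · intro s
    obtain ⟨x, hx, hxs⟩ := hright s
    obtain ⟨i, hi, rfl⟩ := List.getElem_of_mem hx
    exact ⟨⟨i, hi⟩, hxs⟩
  · rw [← hstep _ (hmem i) _ (hmem j) s t a hi hj]
    refine exists_congr fun b => and_congr_right fun _ => ?_
    change ((i : ℕ), b, (j : ℕ)) ∈ T.map _ ↔ _
    simp only [List.mem_map, Prod.exists, Prod.mk.injEq, idxOf_eq_iff hS]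
    constructor
    · rintro ⟨_, _, _, h, rfl, rfl, rfl⟩
      exact h
    · exact fun h => ⟨_, _, _, h, rfl, rfl, rfl⟩

theorem primrec_ofStates {δ : Type*} [Primcodable δ] [Primcodable γ] [Primcodable β]
    {S I F : δ → List γ} {T : δ → List (γ × β × γ)} (hS : Primrec S) (hI : Primrec I)
    (hT : Primrec T) (hF : Primrec F) : Primrec fun z => ofStates (S z) (I z) (T z) (F z) := by
  have hidx {ε : Type _} [Primcodable ε] {f : δ × ε → γ} (hf : Primrec f) :
      Primrec fun z : δ × ε => (S z.1).idxOf (f z) :=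
    Primrec.list_idxOf.comp hf (hS.comp .fst)
  refine (Primrec.list_length.comp hS).pair <| .pair (Primrec.list_map hI (hidx .snd)) <|
    .pair (Primrec.list_map hT ?_) (Primrec.list_map hF (hidx .snd))
  exact (hidx (Primrec.fst.comp .snd)).pair <|
    (Primrec.fst.comp (Primrec.snd.comp .snd)).pair
      (hidx (Primrec.snd.comp (Primrec.snd.comp .snd)))

end NFACode

/-! ### Codes of finite sets -/

/-- The list `l` enumerates the set `A`. -/
def DenotesSet {m : ℕ} (l : List ℕ) (A : Finset (Fin m)) : Prop := A.image Fin.val = l.toFinset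

namespace DenotesSet

variable {m : ℕ} {l : List ℕ} {A B : Finset (Fin m)}

theorem mem_list_iff (h : DenotesSet l A) {i : ℕ} : i ∈ l ↔ ∃ a ∈ A, (a : ℕ) = i := by
  rw [← List.mem_toFinset, ← h, Finset.mem_image]

theorem val_mem_iff (h : DenotesSet l A) {a : Fin m} : a.val ∈ l ↔ a ∈ A := by
  simp [h.mem_list_iff, ← Fin.ext_iff]

theorem forall_mem_iff (h : DenotesSet l A) {φ : ℕ → Prop} :
    (∀ i ∈ l, φ i) ↔ ∀ a ∈ A, φ a.val := by
  simp [h.mem_list_iff]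

theorem exists_mem_iff (h : DenotesSet l A) {φ : ℕ → Prop} :
    (∃ i ∈ l, φ i) ↔ ∃ a ∈ A, φ a.val := by
  simp [h.mem_list_iff]

theorem unique (hA : DenotesSet l A) (hB : DenotesSet l B) : A = B :=
  Finset.image_injective Fin.val_injective (hA.trans hB.symm)

end DenotesSet

theorem exists_denotesSet {m : ℕ} {l : List ℕ} (hl : ∀ i ∈ l, i < m) :
    ∃ A : Finset (Fin m), DenotesSet l A := by
  refine ⟨Finset.univ.filter fun a : Fin m => a.val ∈ l, ?_⟩
  ext i
  simpa [Fin.exists_iff] using hl i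

theorem exists_mem_sublists_denotesSet {m : ℕ} (A : Finset (Fin m)) :
    ∃ l ∈ (List.range m).sublists, DenotesSet l A := by
  refine ⟨(List.range m).filter (· ∈ A.image Fin.val),
    List.mem_sublists.2 List.filter_sublist, ?_⟩
  ext i
  simp only [Finset.mem_image, List.mem_toFinset, List.mem_filter, List.mem_range,
    decide_eq_true_eq]
  exact ⟨fun ⟨a, ha, h⟩ => ⟨h ▸ a.isLt, a, ha, h⟩, And.right⟩

namespace PDSCode

open DependenceAlphabet PushdownSystem

/-! ### Computation of the automata -/

/-- The transitions that write the empty word, reversed and in the form (target, letter, source);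
as in `toPDS`, those with an invalid target are ignored. -/
def popTransitions (c : PDSCode) : List (ℕ × ℕ × ℕ) :=
  (c.2.2.2.filter fun t => t.2.2.1 = [] ∧ t.2.2.2 < c.states).map fun t => (t.2.2.2, t.2.1, t.1)

/-- The code of `popNFA` on letters. -/
def popCode (z : PDSCode × ℕ × ℕ) : NFACode ℕ :=
  (z.1.states, [z.2.2], z.1.popTransitions, [z.2.1])

/-- The states from which popping the letter `a` leads to `X`. -/
def popStep (c : PDSCode) (X : List ℕ) (a : ℕ) : List ℕ :=
  (c.popTransitions.filter fun e => e.1 ∈ X ∧ e.2.1 = a).map fun e => e.2.2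

/-- The states from which popping the word `w` leads to `q`. -/
def popSources (c : PDSCode) (w : List ℕ) (q : ℕ) : List ℕ := w.foldl c.popStep [q]

/-- The dependence relation of `toAlphabet` on the numbers of letters. -/
def CodeDep (c : PDSCode) (a b : ℕ) : Prop := a = b ∨ (a, b) ∈ c.2.2.1 ∨ (b, a) ∈ c.2.2.1

instance (c : PDSCode) (a b : ℕ) : Decidable (c.CodeDep a b) :=
  inferInstanceAs (Decidable (_ ∨ _))

/-- The counterpart of `DependenceAlphabet.Covers` for lists enumerating the sets. -/
def CodeCovers (c : PDSCode) (l l' : List ℕ) : Prop := ∀ b ∈ l', ∃ a ∈ l, c.CodeDep a b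

instance (c : PDSCode) (l l' : List ℕ) : Decidable (c.CodeCovers l l') :=
  inferInstanceAs (Decidable (∀ b ∈ l', ∃ a ∈ l, c.CodeDep a b))

/-- Codes of the states of `reachNFA`, with lists enumerating the three sets. -/
abbrev StateCode : Type := List ℕ × List ℕ × List ℕ × ℕ

/-- Codes of all states of `reachNFA`. -/
def stateCodes (c : PDSCode) : List StateCode :=
  (List.range c.letters).sublists ×ˢ (List.range c.letters).sublists ×ˢ
    (List.range c.letters).sublists ×ˢ List.range c.states

/-- The transitions of `reachNFA` on codes of states. The letter read is `(y.1, y.2.1)`, since the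
first two components of a state are the sets read last. -/
def CodeStep (c : PDSCode) (x y : StateCode) : Prop :=
  c.CodeCovers x.1 y.1 ∧ c.CodeCovers x.2.1 y.2.1 ∧
    (y.2.1 ⊆ y.1 ∧ x.2.2.1 ⊆ y.2.2.1 ∧ (y.1.filter fun a => a ∉ y.2.1) ⊆ y.2.2.1 ∧
      ∀ a ∈ x.2.2.1, ∀ b ∈ y.2.1, ¬ c.CodeDep a b) ∧
    y.2.2.2 ∈ c.popSources (y.1.filter fun a => a ∉ y.2.1) x.2.2.2

instance (c : PDSCode) (x y : StateCode) : Decidable (c.CodeStep x y) :=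
  inferInstanceAs (Decidable (_ ∧ _))

/-- The code of `reachNFA`. -/
def reachCode (z : PDSCode × ℕ × ℕ) : NFACode (List ℕ × List ℕ) :=
  .ofStates z.1.stateCodes (z.1.stateCodes.filter fun x => x.2.2.2 = z.2.2)
    (((z.1.stateCodes ×ˢ z.1.stateCodes).filter fun e => z.1.CodeStep e.1 e.2).map
      fun e => (e.1, (e.2.1, e.2.2.1), e.2))
    (z.1.stateCodes.filter fun x => x.2.2.2 = z.2.1)

section Computability

open Primrec

variable {α : Type*} [Primcodable α] {c : α → PDSCode}

theorem primrec_states : Primrec states := fst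

theorem primrec_letters : Primrec letters := fst.comp snd

theorem primrec_popTransitions : Primrec popTransitions := by
  have hword : Primrec fun t : ℕ × ℕ × List ℕ × ℕ => t.2.2.1 := fst.comp (snd.comp snd)
  have htarget : Primrec fun t : ℕ × ℕ × List ℕ × ℕ => t.2.2.2 := snd.comp (snd.comp snd)
  refine list_map (primrec_filter (snd.comp (snd.comp snd)) ?_) ?_
  · exact (Primrec.eq.comp (hword.comp snd) (const [])).and
      (nat_lt.comp (htarget.comp snd) (primrec_states.comp fst))
  · exact (htarget.comp snd).pair ((fst.comp (snd.comp snd)).pair (fst.comp snd))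

theorem primrec_popCode : Primrec popCode :=
  (primrec_states.comp fst).pair <| (list_cons.comp (snd.comp snd) (const [])).pair <|
    (primrec_popTransitions.comp fst).pair (list_cons.comp (fst.comp snd) (const []))

theorem primrec_popStep {X : α → List ℕ} {a : α → ℕ} (hc : Primrec c) (hX : Primrec X)
    (ha : Primrec a) : Primrec fun z => popStep (c z) (X z) (a z) := by
  refine list_map (primrec_filter (primrec_popTransitions.comp hc) ?_) (snd.comp (snd.comp snd))
  exact (primrecPred_mem (fst.comp snd) (hX.comp fst)).and
    (Primrec.eq.comp (fst.comp (snd.comp snd)) (ha.comp fst))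

theorem primrec_popSources {w : α → List ℕ} {q : α → ℕ} (hc : Primrec c) (hw : Primrec w)
    (hq : Primrec q) : Primrec fun z => popSources (c z) (w z) (q z) :=
  list_foldl hw (list_cons.comp hq (const []))
    (primrec_popStep (hc.comp fst) (fst.comp snd) (snd.comp snd)).to₂

theorem primrecPred_codeDep {a b : α → ℕ} (hc : Primrec c) (ha : Primrec a) (hb : Primrec b) :
    PrimrecPred fun z => (c z).CodeDep (a z) (b z) :=
  have hpairs : Primrec fun z => (c z).2.2.1 := fst.comp (snd.comp (snd.comp hc))
  (Primrec.eq.comp ha hb).or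
    ((primrecPred_mem (ha.pair hb) hpairs).or (primrecPred_mem (hb.pair ha) hpairs))

theorem primrecPred_codeCovers {l l' : α → List ℕ} (hc : Primrec c) (hl : Primrec l)
    (hl' : Primrec l') : PrimrecPred fun z => (c z).CodeCovers (l z) (l' z) :=
  primrecPred_forall_mem hl' <| primrecPred_exists_mem (hl.comp fst) <|
    primrecPred_codeDep (hc.comp (fst.comp fst)) snd (snd.comp fst)

theorem primrecPred_codeStep {x y : α → StateCode} (hc : Primrec c) (hx : Primrec x)
    (hy : Primrec y) : PrimrecPred fun z => (c z).CodeStep (x z) (y z) := by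
  have x₁ : Primrec fun z => (x z).1 := fst.comp hx
  have x₂ : Primrec fun z => (x z).2.1 := fst.comp (snd.comp hx)
  have x₃ : Primrec fun z => (x z).2.2.1 := fst.comp (snd.comp (snd.comp hx))
  have x₄ : Primrec fun z => (x z).2.2.2 := snd.comp (snd.comp (snd.comp hx))
  have y₁ : Primrec fun z => (y z).1 := fst.comp hy
  have y₂ : Primrec fun z => (y z).2.1 := fst.comp (snd.comp hy)
  have y₃ : Primrec fun z => (y z).2.2.1 := fst.comp (snd.comp (snd.comp hy))
  have y₄ : Primrec fun z => (y z).2.2.2 := snd.comp (snd.comp (snd.comp hy))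
  have hdiff : Primrec fun z => (y z).1.filter fun a => a ∉ (y z).2.1 :=
    primrec_filter y₁ (primrecPred_mem snd (y₂.comp fst)).not
  have hindep : PrimrecPred fun z => ∀ a ∈ (x z).2.2.1, ∀ b ∈ (y z).2.1, ¬ (c z).CodeDep a b :=
    primrecPred_forall_mem x₃ <| primrecPred_forall_mem (y₂.comp fst) <|
      (primrecPred_codeDep (hc.comp (fst.comp fst)) (snd.comp fst) snd).not
  exact (primrecPred_codeCovers hc x₁ y₁).and <| (primrecPred_codeCovers hc x₂ y₂).and <|
    ((primrecPred_subset y₂ y₁).and <| (primrecPred_subset x₃ y₃).and <|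
      (primrecPred_subset hdiff y₃).and hindep).and <|
    primrecPred_mem y₄ (primrec_popSources hc hdiff x₄)

theorem primrec_stateCodes : Primrec stateCodes :=
  have h : Primrec fun c : PDSCode => (List.range c.letters).sublists :=
    primrec_sublists.comp (list_range.comp primrec_letters)
  primrec_product h <| primrec_product h <| primrec_product h (list_range.comp primrec_states)

theorem primrec_reachCode : Primrec reachCode := by
  have hcodes : Primrec fun z : PDSCode × ℕ × ℕ => z.1.stateCodes := primrec_stateCodes.comp fst
  have hstate : Primrec fun u : (PDSCode × ℕ × ℕ) × StateCode => u.2.2.2.2 :=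
    snd.comp (snd.comp (snd.comp snd))
  refine NFACode.primrec_ofStates hcodes
    (primrec_filter hcodes (Primrec.eq.comp hstate (snd.comp (snd.comp fst))))
    (list_map (primrec_filter (primrec_product hcodes hcodes) ?_) ?_)
    (primrec_filter hcodes (Primrec.eq.comp hstate (fst.comp (snd.comp fst))))
  · exact primrecPred_codeStep (fst.comp fst) (fst.comp snd) (snd.comp snd)
  · have htarget : Primrec fun u : (PDSCode × ℕ × ℕ) × StateCode × StateCode => u.2.2 :=
      snd.comp snd
    exact (fst.comp snd).pair <| .pair (.pair (fst.comp htarget) (fst.comp (snd.comp htarget)))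
      htarget

end Computability

/-! ### Correctness of the computed automata -/

variable {c : PDSCode}

theorem mem_popTransitions {p q : ℕ} {a : ℕ} :
    (q, a, p) ∈ c.popTransitions ↔ (p, a, [], q) ∈ c.2.2.2 ∧ q < c.states := by
  simp only [popTransitions, List.mem_map, List.mem_filter, decide_eq_true_eq, Prod.exists,
    Prod.mk.injEq]
  grind

theorem accepts_popCode (hP : c.toPDS.IsTPDS) (p q : Fin c.states) :
    ((popCode (c, p.val, q.val)).toNFA DenotesLetter).accepts =
      (popNFA (fun a => c.toPDS.alph.trace [a]) p q).accepts := by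
  refine accepts_eq_of_biTotal (R := Eq) ⟨fun s => ⟨s, rfl⟩, fun s => ⟨s, rfl⟩⟩ ?_ ?_ ?_
  · rintro s _ rfl
    exact List.mem_singleton.trans Fin.ext_iff.symm
  · rintro s _ r _ a rfl rfl
    refine Iff.trans ?_ (trace_singleton_mem_popSet hP).symm
    change (∃ b, a.val = b ∧ (s.val, b, r.val) ∈ c.popTransitions) ↔
      (r.val, a.val, [], s.val) ∈ c.2.2.2
    rw [exists_eq_left', mem_popTransitions]
    exact and_iff_left s.isLt
  · rintro s _ rfl
    exact List.mem_singleton.trans Fin.ext_iff.symm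

theorem mem_popStep {X : List ℕ} {a r : ℕ} :
    r ∈ c.popStep X a ↔ ∃ s ∈ X, (r, a, [], s) ∈ c.2.2.2 ∧ s < c.states := by
  simp only [popStep, List.mem_map, List.mem_filter, decide_eq_true_eq, Prod.exists,
    ← mem_popTransitions]
  grind

theorem mem_foldl_popStep {X : List ℕ} {w : List (Fin c.letters)} {p : Fin c.states} :
    p.val ∈ (w.map Fin.val).foldl c.popStep X ↔ ∃ s, s.val ∈ X ∧ c.toPDS.PopPath p w s := by
  induction w generalizing X with
  | nil => simp [PopPath]
  | cons a w ih =>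
    simp only [List.map_cons, List.foldl_cons, ih, PopPath, mem_popStep]
    constructor
    · rintro ⟨r, ⟨s, hX, h, hs⟩, hr⟩
      exact ⟨⟨s, hs⟩, hX, r, hr, h⟩
    · rintro ⟨s, hX, r, hr, h⟩
      exact ⟨r, ⟨s, hX, h, s.isLt⟩, hr⟩

theorem mem_popSources {w : List (Fin c.letters)} {p q : Fin c.states} :
    p.val ∈ c.popSources (w.map Fin.val) q ↔ c.toPDS.PopPath p w q := by
  simp [popSources, mem_foldl_popStep, ← Fin.ext_iff]

theorem codeDep_iff {a b : Fin c.letters} : c.CodeDep a b ↔ c.toPDS.alph.Dep a b :=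
  or_congr_left Fin.ext_iff.symm

theorem codeCovers_iff {l l' : List ℕ} {A B : Finset (Fin c.letters)} (hA : DenotesSet l A)
    (hB : DenotesSet l' B) : c.CodeCovers l l' ↔ c.toPDS.alph.Covers A B := by
  simp only [CodeCovers, Covers, hB.forall_mem_iff, hA.exists_mem_iff, codeDep_iff]

theorem mem_popSources_iff_trace_mem (hP : c.toPDS.IsTPDS) {l : List ℕ} (hl : l.Nodup)
    {A : c.toPDS.alph.IndepSet} (hA : DenotesSet l A.1) {p q : Fin c.states} :
    p.val ∈ c.popSources l q ↔ A.trace ∈ c.toPDS.popSet p q := by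
  obtain ⟨w, rfl⟩ : ∃ w : List (Fin c.letters), w.map Fin.val = l :=
    ⟨l.pmap Fin.mk fun i hi => by obtain ⟨a, -, rfl⟩ := hA.mem_list_iff.1 hi; exact a.isLt,
      by simp [List.map_pmap]⟩
  rw [A.trace_eq_of_nodup hl.of_map fun a => by
    rw [← hA.val_mem_iff, List.mem_map_of_injective Fin.val_injective],
    trace_mem_popSet hP, mem_popSources]

theorem denotesSet_diff {l l' : List ℕ} {A B : c.toPDS.alph.IndepSet} (hA : DenotesSet l A.1)
    (hB : DenotesSet l' B.1) : DenotesSet (l.filter fun a => a ∉ l') (A.diff B).1 := by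
  ext i
  simp only [Finset.mem_image, IndepSet.mem_diff, List.mem_toFinset, List.mem_filter,
    decide_eq_true_eq]
  grind [hA.mem_list_iff, hB.val_mem_iff]

theorem mem_stateCodes {x : StateCode} :
    x ∈ c.stateCodes ↔ x.1 ∈ (List.range c.letters).sublists ∧
      x.2.1 ∈ (List.range c.letters).sublists ∧ x.2.2.1 ∈ (List.range c.letters).sublists ∧
      x.2.2.2 < c.states := by
  obtain ⟨A, B, S, s⟩ := x
  simp only [stateCodes, List.mem_product, List.mem_range]

theorem nodup_stateCodes : c.stateCodes.Nodup :=
  have h := List.nodup_sublists.2 (List.nodup_range (n := c.letters))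
  h.product <| h.product <| h.product List.nodup_range

/-- The code `x` describes the state `s` of `reachNFA`. -/
def DenotesState (x : StateCode)
    (s : Finset (Fin c.letters) × Finset (Fin c.letters) × Finset (Fin c.letters) ×
      Fin c.states) : Prop :=
  DenotesSet x.1 s.1 ∧ DenotesSet x.2.1 s.2.1 ∧ DenotesSet x.2.2.1 s.2.2.1 ∧
    x.2.2.2 = s.2.2.2.val

theorem exists_denotesState {x : StateCode} (hx : x ∈ c.stateCodes) :
    ∃ s, DenotesState (c := c) x s := by
  have hset {l : List ℕ} (hl : l ∈ (List.range c.letters).sublists) :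
      ∃ A : Finset (Fin c.letters), DenotesSet l A :=
    exists_denotesSet fun i hi => List.mem_range.1 ((List.mem_sublists.1 hl).subset hi)
  obtain ⟨hA, hB, hS, hq⟩ := mem_stateCodes.1 hx
  obtain ⟨⟨A, hA⟩, ⟨B, hB⟩, ⟨S, hS⟩⟩ := And.intro (hset hA) (And.intro (hset hB) (hset hS))
  exact ⟨(A, B, S, ⟨x.2.2.2, hq⟩), hA, hB, hS, rfl⟩

theorem exists_mem_stateCodes_denotesState (s : Finset (Fin c.letters) × Finset (Fin c.letters) ×
    Finset (Fin c.letters) × Fin c.states) : ∃ x ∈ c.stateCodes, DenotesState x s := by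
  obtain ⟨A, B, S, q⟩ := s
  obtain ⟨a, ha, hA⟩ := exists_mem_sublists_denotesSet A
  obtain ⟨b, hb, hB⟩ := exists_mem_sublists_denotesSet B
  obtain ⟨l, hl, hS⟩ := exists_mem_sublists_denotesSet S
  exact ⟨(a, b, l, q), mem_stateCodes.2 ⟨ha, hb, hl, q.isLt⟩, hA, hB, hS, rfl⟩

theorem codeStep_iff (hP : c.toPDS.IsTPDS) {p q : Fin c.states} {x y : StateCode}
    (hy : y.1.Nodup)
    {s t : Finset (Fin c.letters) × Finset (Fin c.letters) × Finset (Fin c.letters) ×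
      Fin c.states}
    (hxs : DenotesState x s) (hyt : DenotesState y t)
    {L : c.toPDS.alph.IndepSet × c.toPDS.alph.IndepSet} :
    DenotesPair c.toPDS.alph (y.1, y.2.1) L ∧ c.CodeStep x y ↔
      t ∈ (c.toPDS.reachNFA p q).step s L := by
  obtain ⟨x₁, x₂, x₃, x₄⟩ := hxs
  obtain ⟨A, B, S, r⟩ := t
  obtain ⟨y₁, y₂, y₃, y₄⟩ := hyt
  suffices A = L.1.1 → B = L.2.1 → (c.CodeStep x y ↔ c.toPDS.alph.Covers s.1 L.1.1 ∧
      c.toPDS.alph.Covers s.2.1 L.2.1 ∧ S ∈ c.toPDS.alph.prefixNFA.step s.2.2.1 L ∧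
      (L.1.diff L.2).trace ∈ c.toPDS.popSet r s.2.2.2) by
    have hpair : DenotesPair c.toPDS.alph (y.1, y.2.1) L ↔ A = L.1.1 ∧ B = L.2.1 :=
      ⟨fun h => ⟨y₁.unique h.1, y₂.unique h.2⟩, fun h => ⟨h.1 ▸ y₁, h.2 ▸ y₂⟩⟩
    change _ ↔ (A = L.1.1 ∧ _) ∧ (B = L.2.1 ∧ _) ∧ _ ∧ _
    rw [hpair]
    tauto
  rintro rfl rfl
  have hdiff := denotesSet_diff y₁ y₂
  simp only [CodeStep, codeCovers_iff x₁ y₁, codeCovers_iff x₂ y₂, x₄, y₄,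
    mem_popSources_iff_trace_mem hP (hy.filter _) hdiff]
  simp only [prefixNFA, Set.mem_ofPred_eq, List.subset_def, Finset.subset_iff, x₃.forall_mem_iff,
    y₂.forall_mem_iff, hdiff.forall_mem_iff, y₁.val_mem_iff, y₃.val_mem_iff, codeDep_iff,
    indep_iff_not_dep]

theorem accepts_reachCode (hP : c.toPDS.IsTPDS) (p q : Fin c.states) :
    ((reachCode (c, p.val, q.val)).toNFA (DenotesPair c.toPDS.alph)).accepts =
      (c.toPDS.reachNFA p q).accepts := by
  refine NFACode.accepts_ofStates (R := DenotesState) nodup_stateCodes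
    (fun x => exists_denotesState) exists_mem_stateCodes_denotesState (fun x hx s hs => ?_)
    (fun x hx y hy s t L hs ht => ?_) fun x hx s hs => ?_
  · exact (List.mem_filter.trans (and_iff_right hx)).trans <| by
      simp [hs.2.2.2, reachNFA, interNFA, comapNFA, chainNFA, prefixNFA, popNFA, Fin.ext_iff]
  · rw [← codeStep_iff hP ((List.mem_sublists.1 (mem_stateCodes.1 hy).1).nodup List.nodup_range)
      hs ht]
    simp only [List.mem_map, List.mem_filter, decide_eq_true_eq, Prod.mk.injEq]
    constructor
    · rintro ⟨_, hb, ⟨_, _⟩, ⟨-, h⟩, rfl, rfl, rfl⟩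
      exact ⟨hb, h⟩
    · exact fun h => ⟨_, h.1, (x, y), ⟨List.mem_product.2 ⟨hx, hy⟩, h.2⟩, rfl, rfl, rfl⟩
  · exact (List.mem_filter.trans (and_iff_right hx)).trans <| by
      simp [hs.2.2.2, reachNFA, interNFA, comapNFA, chainNFA, prefixNFA, popNFA, Fin.ext_iff]

end PDSCode

/-- For a trace-pushdown system all of whose transitions write the empty word, every relation
`reach_{p,q}` is fnf-automatic and of the form `Id · (K × {1})` with `K` recognizable. Moreover,
automata for `reach_{p,q}` and for `K` can be computed from the system and the two states. -/
theorem mainTheorem8 :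
    (∀ (Q : Type*) (Γ : Type*) [Finite Q] [Finite Γ] (P : PushdownSystem Q Γ),
      P.IsTPDS → P.WritesEmpty → ∀ p q : Q,
        P.alph.FnfAutomatic (P.reach p q) ∧
        ∃ K : Set P.alph.Trace, P.alph.Recognizable K ∧
          P.reach p q = P.alph.idRel * (K ×ˢ {1})) ∧
    ∃ (autReach : PDSCode × ℕ × ℕ → NFACode (List ℕ × List ℕ))
      (autK : PDSCode × ℕ × ℕ → NFACode ℕ),
      Computable autReach ∧ Computable autK ∧
      ∀ c : PDSCode, c.toPDS.IsTPDS → c.toPDS.WritesEmpty → ∀ p q : Fin c.states,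
        ((autReach (c, p.val, q.val)).toNFA (DenotesPair c.toPDS.alph)).accepts =
          c.toPDS.alph.foataLanguage (c.toPDS.reach p q) ∧
        ∃ K : Set c.toPDS.alph.Trace,
          ((autK (c, p.val, q.val)).toNFA DenotesLetter).accepts =
            ({w | c.toPDS.alph.trace w ∈ K} : Language (Fin c.letters)) ∧
          c.toPDS.reach p q = c.toPDS.alph.idRel * (K ×ˢ {1}) := by
  refine ⟨fun Q Γ _ _ P hP hE p q => ⟨?_, P.popSet p q, ?_, P.reach_eq hP hE p q⟩,
    PDSCode.reachCode, PDSCode.popCode, PDSCode.primrec_reachCode.to_comp,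
    PDSCode.primrec_popCode.to_comp, fun c hP hE p q => ⟨?_, c.toPDS.popSet p q, ?_,
      c.toPDS.reach_eq hP hE p q⟩⟩
  · have := Fintype.ofFinite Γ
    rw [DependenceAlphabet.FnfAutomatic, ← PushdownSystem.accepts_reachNFA hP hE p q]
    exact isRegular_accepts _
  · rw [DependenceAlphabet.Recognizable, ← PushdownSystem.accepts_popNFA_letters hP p q]
    exact isRegular_accepts _
  · rw [PDSCode.accepts_reachCode hP p q, PushdownSystem.accepts_reachNFA hP hE p q]
  · rw [PDSCode.accepts_popCode hP p q, PushdownSystem.accepts_popNFA_letters hP p q]
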